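/- All graphs are finite and simple. For a graph $G$ with vertex set $V\neq\emptyset$, a dual orthonormal representation of $G$ in $\mathbb{R}^d$ is a family of unit vectors $u_i\in\mathbb{R}^d$ $(i\in V)$ such that $\langle u_i,u_j\rangle=0$ whenever $ij\in E(G)$. The complementary Lovász theta number of $G$ is $$\overline{\vartheta}(G)=\min_{d,\,u,\,c}\ \max_{i\in V}\frac{1}{\langle c,u_i\rangle^2},$$ where the minimum is over all dimensions $d\ge 1$, all dual orthonormal representations $u=(u_i)_{i\in V}$ of $G$ in $\mathbb{R}^d$ and all unit vectors $c\in\mathbb{R}^d$ (with $1/0=+\infty$). The Mycielskian $M(G)$ has vertex set $(V\times\{0,1\})\cup\{z\}$ and edges $\{(v,0),(w,i)\}$ for $vw\in E(G)$, $i\in\{0,1\}$, and $\{z,(v,1)\}$ for $v\in V$. **Theorem.** Let $G$ be a graph with at least one vertex and let $t=\overline{\vartheta}(G)$. The minima defining $\overline{\vartheta}(G)$ and $\overline{\vartheta}(M(G))$ are attained, and $$\overline{\vartheta}(M(G))=\frac43\,t\cos\left(\frac13\arccos\left(1-\frac{27}{4t}+\frac{27}{4t^2}\right)\right)-\frac13\,t+1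 .$$ Moreover, $\overline{\vartheta}(M(G))$ is the largest real root of the cubic $$x^3+(t-3)x^2+(3-2t-t^2)x+(-t^3+5t^2-3t-1)=0 .$$ -/

import Mathlib

/-- The Mycielskian `M(G)`. Its vertices are the pairs `(v, i)` with `v` a vertex of `G` and
`i ∈ {0, 1}`, together with one further vertex `z`, here `Sum.inr ()`. The edges are
`{(v, 0), (w, i)}` for `{v, w}` an edge of `G` and `i ∈ {0, 1}`, and `{z, (v, 1)}` for every `v`. -/
def mycielskian {V : Type*} (G : SimpleGraph V) : SimpleGraph ((V × Fin 2) ⊕ Unit) where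
  Adj a b :=
    match a, b with
    | Sum.inl (v, i), Sum.inl (w, j) => G.Adj v w ∧ (i = 0 ∨ j = 0)
    | Sum.inl (_, i), Sum.inr _ => i = 1
    | Sum.inr _, Sum.inl (_, j) => j = 1
    | Sum.inr _, Sum.inr _ => False
  symm := ⟨by
    rintro (⟨v, i⟩ | z) (⟨w, j⟩ | z') h
    · exact ⟨h.1.symm, h.2.symm⟩
    · exact h
    · exact h
    · exact h⟩
  loopless := ⟨by
    rintro (⟨v, i⟩ | z) h
    · exact G.irrefl h.1
    · exact h⟩

/-- An orthonormal representation of `G` in `ℝ^d`: unit vectors, orthogonal for any two distinct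
non-adjacent vertices. -/
def IsOrthonormalRep {V : Type*} (G : SimpleGraph V) {d : ℕ}
    (u : V → EuclideanSpace ℝ (Fin d)) : Prop :=
  (∀ i, ‖u i‖ = 1) ∧ ∀ i j, i ≠ j → ¬ G.Adj i j → inner ℝ (u i) (u j) = 0

/-- A dual orthonormal representation of `G` is an orthonormal representation of its complement. -/
def IsDualOrthonormalRep {V : Type*} (G : SimpleGraph V) {d : ℕ}
    (u : V → EuclideanSpace ℝ (Fin d)) : Prop :=
  IsOrthonormalRep Gᶜ u

/-- The finite values of `max_i 1 / ⟨c, u_i⟩²`, where `u` runs over the dual orthonormal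
representations of `G`, in any dimension `d`, and `c` over the unit vectors of `ℝ^d`. If some
`⟨c, u_i⟩` vanishes the maximum is `+∞`, so such pairs contribute nothing to the minimum. -/
def thetaBarValues {V : Type*} (G : SimpleGraph V) : Set ℝ :=
  {r | ∃ (d : ℕ) (u : V → EuclideanSpace ℝ (Fin d)) (c : EuclideanSpace ℝ (Fin d)),
    IsDualOrthonormalRep G u ∧ ‖c‖ = 1 ∧ (∀ i, inner ℝ c (u i) ≠ 0) ∧
    IsGreatest (Set.range fun i => 1 / (inner ℝ c (u i)) ^ 2) r}

/-- The complementary Lovász theta number, the minimum of `thetaBarValues G`. -/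
noncomputable def thetaBar {V : Type*} (G : SimpleGraph V) : ℝ :=
  sInf (thetaBarValues G)

/-! Passing from `u_i` to `y_i = u_i / ⟨c, u_i⟩ - c` makes the program semidefinite
(`mem_thetaBarValues_iff`), so minima exist by compactness. With `x = u + 1`, the optimum sought for
`M(G)` is the largest root `u` of `(u + t)² (t - u) = 4 t (t - 1)`.

Upper bound (`thetaFeasible_mycielskian`): optimal vectors of `G` are rescaled and given one extra
coordinate, which also carries `z`.

Lower bound (`le_of_thetaFeasible_mycielskian`): strong duality (`exists_dual_optimal`) gives a
kernel `B` with diagonal part `D` such that `B` and `t D - B` are both PSD. Pairing them with the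
vectors of any feasible kernel of `M(G)` yields inequalities that are equalities at the construction
above; a weighted sum of them is the bound. One parameter `r`, rational in `t` and `u`, serves both
directions (`exists_cubic_param`). -/

/-! ### Positive semidefinite kernels -/

/-- A symmetric real kernel on a finite type whose quadratic form is nonnegative. -/
structure IsPSDKernel {V : Type*} [Fintype V] (Y : V → V → ℝ) : Prop where
  symm : ∀ i j, Y i j = Y j i
  nonneg : ∀ x : V → ℝ, 0 ≤ ∑ i, ∑ j, x i * x j * Y i j

namespace IsPSDKernel

variable {V : Type*} [Fintype V]

theorem of_inner {E : Type*} [NormedAddCommGroup E] [InnerProductSpace ℝ E] (y : V → E) :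
    IsPSDKernel fun i j => inner ℝ (y i) (y j) where
  symm i j := real_inner_comm _ _
  nonneg x := by
    have h : ∑ i, ∑ j, x i * x j * inner ℝ (y i) (y j) =
        inner ℝ (∑ i, x i • y i) (∑ j, x j • y j) := by
      simp only [sum_inner, inner_sum, real_inner_smul_left, real_inner_smul_right, mul_assoc]
      rw [Finset.sum_comm]
      exact Finset.sum_congr rfl fun i _ => Finset.sum_congr rfl fun j _ => by ring
    rw [h]
    exact real_inner_self_nonneg

theorem exists_inner {Y : V → V → ℝ} (hY : IsPSDKernel Y) :
    ∃ (m : ℕ) (y : V → EuclideanSpace ℝ (Fin m)), ∀ i j, Y i j = inner ℝ (y i) (y j) := by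
  have hM : (Matrix.of Y).PosSemidef := by
    refine Matrix.PosSemidef.of_dotProduct_mulVec_nonneg ?_ fun x => ?_
    · ext i j
      simpa using hY.symm j i
    · have h := hY.nonneg x
      simp only [dotProduct, Matrix.mulVec, Pi.star_apply, star_trivial, Matrix.of_apply,
        Finset.mul_sum]
      refine h.trans_eq (Finset.sum_congr rfl fun i _ => Finset.sum_congr rfl fun j _ => ?_)
      ring
  obtain ⟨m, v, hv⟩ := Matrix.posSemidef_iff_eq_sum_vecMulVec.mp hM
  refine ⟨m, fun i => WithLp.toLp 2 fun k => v k i, fun i j => ?_⟩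
  have h := congrFun (congrFun hv i) j
  simp only [Matrix.of_apply, Matrix.sum_apply, Matrix.vecMulVec_apply, star_trivial] at h
  rw [h]
  simp only [PiLp.inner_apply, RCLike.inner_apply, conj_trivial]
  exact Finset.sum_congr rfl fun k _ => mul_comm _ _

theorem add {Y Z : V → V → ℝ} (hY : IsPSDKernel Y) (hZ : IsPSDKernel Z) :
    IsPSDKernel fun i j => Y i j + Z i j where
  symm i j := by rw [hY.symm, hZ.symm]
  nonneg x := by
    simp only [mul_add, Finset.sum_add_distrib]
    exact add_nonneg (hY.nonneg x) (hZ.nonneg x)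

theorem smul {Y : V → V → ℝ} (hY : IsPSDKernel Y) {c : ℝ} (hc : 0 ≤ c) :
    IsPSDKernel fun i j => c * Y i j where
  symm i j := by rw [hY.symm]
  nonneg x := by
    have h : ∑ i, ∑ j, x i * x j * (c * Y i j) = c * ∑ i, ∑ j, x i * x j * Y i j := by
      simp only [Finset.mul_sum]
      exact Finset.sum_congr rfl fun i _ => Finset.sum_congr rfl fun j _ => by ring
    rw [h]
    exact mul_nonneg hc (hY.nonneg x)

theorem scale {Y : V → V → ℝ} (hY : IsPSDKernel Y) (a : V → ℝ) :
    IsPSDKernel fun i j => a i * a j * Y i j where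
  symm i j := by rw [hY.symm, mul_comm (a i)]
  nonneg x := by
    refine (hY.nonneg fun i => x i * a i).trans_eq ?_
    exact Finset.sum_congr rfl fun i _ => Finset.sum_congr rfl fun j _ => by ring

theorem diagonal [DecidableEq V] {d : V → ℝ} (hd : ∀ i, 0 ≤ d i) :
    IsPSDKernel fun i j => if i = j then d i else 0 where
  symm i j := by
    by_cases h : i = j
    · simp [h]
    · simp [h, Ne.symm h]
  nonneg x := by
    simp only [mul_ite, mul_zero, Finset.sum_ite_eq, Finset.mem_univ, if_true]
    exact Finset.sum_nonneg fun i _ => mul_nonneg (mul_self_nonneg _) (hd i)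

theorem diag_nonneg {Y : V → V → ℝ} (hY : IsPSDKernel Y) (i : V) : 0 ≤ Y i i := by
  obtain ⟨m, y, hy⟩ := hY.exists_inner
  rw [hy]
  exact real_inner_self_nonneg

theorem two_mul_abs_le {Y : V → V → ℝ} (hY : IsPSDKernel Y) (i j : V) :
    2 * |Y i j| ≤ Y i i + Y j j := by
  obtain ⟨m, y, hy⟩ := hY.exists_inner
  have h₁ := real_inner_self_nonneg (x := y i + y j)
  have h₂ := real_inner_self_nonneg (x := y i - y j)
  rw [real_inner_add_add_self, ← hy, ← hy, ← hy] at h₁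
  rw [real_inner_sub_sub_self, ← hy, ← hy, ← hy] at h₂
  have : |Y i j| ≤ (Y i i + Y j j) / 2 := abs_le.mpr ⟨by linarith, by linarith⟩
  linarith

/-- Each coordinate of the vectors contributes one value of the quadratic form of `B`. -/
theorem sum_inner_nonneg {B : V → V → ℝ} (hB : IsPSDKernel B) {m : ℕ}
    (x : V → EuclideanSpace ℝ (Fin m)) : 0 ≤ ∑ i, ∑ j, B i j * inner ℝ (x i) (x j) := by
  have h : ∑ i, ∑ j, B i j * inner ℝ (x i) (x j) =
      ∑ k, ∑ i, ∑ j, x i k * x j k * B i j := by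
    rw [Finset.sum_comm]
    conv_rhs => rw [Finset.sum_comm]
    rw [Finset.sum_comm]
    refine Finset.sum_congr rfl fun i _ => ?_
    rw [Finset.sum_comm]
    refine Finset.sum_congr rfl fun j _ => ?_
    rw [PiLp.inner_apply, Finset.mul_sum]
    refine Finset.sum_congr rfl fun k _ => ?_
    simp only [RCLike.inner_apply, conj_trivial]
    ring
  rw [h]
  exact Finset.sum_nonneg fun k _ => hB.nonneg _

theorem isClosed_setOf : IsClosed {Y : V → V → ℝ | IsPSDKernel Y} := by
  have h : {Y : V → V → ℝ | IsPSDKernel Y} =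
      {Y | ∀ i j, Y i j = Y j i} ∩ {Y | ∀ x : V → ℝ, 0 ≤ ∑ i, ∑ j, x i * x j * Y i j} :=
    Set.ext fun Y => ⟨fun h => ⟨h.1, h.2⟩, fun h => ⟨h.1, h.2⟩⟩
  rw [h]
  refine IsClosed.inter ?_ ?_
  · simp only [Set.ofPred_forall]
    exact isClosed_iInter fun i => isClosed_iInter fun j =>
      isClosed_eq (by fun_prop) (by fun_prop)
  · simp only [Set.ofPred_forall]
    exact isClosed_iInter fun x => isClosed_le (by fun_prop) (by fun_prop)

theorem isBounded_setOf_diag_le (C : ℝ) :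
    Bornology.IsBounded {Y : V → V → ℝ | IsPSDKernel Y ∧ ∀ i, Y i i ≤ C} := by
  refine (Metric.isBounded_closedBall (x := (0 : V → V → ℝ)) (r := |C|)).subset ?_
  rintro Y ⟨hY, hC⟩
  rw [mem_closedBall_zero_iff, pi_norm_le_iff_of_nonneg (abs_nonneg C)]
  intro i
  rw [pi_norm_le_iff_of_nonneg (abs_nonneg C)]
  intro j
  rw [Real.norm_eq_abs]
  have := hY.two_mul_abs_le i j
  have := hC i
  have := hC j
  have := le_abs_self C
  linarith

end IsPSDKernel

/-! ### Semidefinite form of the theta number; attainment -/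

/-- A PSD kernel on the vertices of `G` that is `-1` on the edges and at most `T` on the
diagonal. Such a kernel exists exactly if `1 + T` is a value of the program that defines
`thetaBar G`. -/
def ThetaFeasible {V : Type*} [Fintype V] (G : SimpleGraph V) (T : ℝ) : Prop :=
  ∃ Y : V → V → ℝ, IsPSDKernel Y ∧ (∀ i, Y i i ≤ T) ∧ ∀ i j, G.Adj i j → Y i j = -1

theorem inner_toLp_pair {F : Type*} [NormedAddCommGroup F] [InnerProductSpace ℝ F] (a b : ℝ)
    (x y : F) : inner ℝ (WithLp.toLp 2 (a, x)) (WithLp.toLp 2 (b, y)) = a * b + inner ℝ x y := by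
  rw [WithLp.prod_inner_apply]
  simp [mul_comm]

section Feasible

variable {V : Type*} [Fintype V] {G : SimpleGraph V}

theorem ThetaFeasible.nonneg [Nonempty V] {T : ℝ} (h : ThetaFeasible G T) : 0 ≤ T := by
  obtain ⟨Y, hY, hd, -⟩ := h
  obtain ⟨i⟩ := ‹Nonempty V›
  exact (hY.diag_nonneg i).trans (hd i)

theorem ThetaFeasible.exists_diag_eq {T : ℝ} (h : ThetaFeasible G T) :
    ∃ Y : V → V → ℝ, IsPSDKernel Y ∧ (∀ i, Y i i = T) ∧ ∀ i j, G.Adj i j → Y i j = -1 := by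
  classical
  obtain ⟨Y, hY, hd, he⟩ := h
  refine ⟨_, hY.add (IsPSDKernel.diagonal (d := fun i => T - Y i i) fun i => sub_nonneg.2 (hd i)),
    fun i => by simp, fun i j hij => ?_⟩
  simp [hij.ne, he i j hij]

theorem ThetaFeasible.of_mem_thetaBarValues {r : ℝ} (h : r ∈ thetaBarValues G) :
    ThetaFeasible G (r - 1) := by
  obtain ⟨d, u, c, hu, hc, hne, hr⟩ := h
  have key : ∀ i j, inner ℝ ((inner ℝ c (u i))⁻¹ • u i - c) ((inner ℝ c (u j))⁻¹ • u j - c) =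
      (inner ℝ c (u i))⁻¹ * (inner ℝ c (u j))⁻¹ * inner ℝ (u i) (u j) - 1 := by
    intro i j
    have hcc : inner ℝ c c = 1 := by rw [real_inner_self_eq_norm_sq, hc]; norm_num
    have hi := hne i
    have hj := hne j
    rw [inner_sub_left, inner_sub_right, inner_sub_right, real_inner_smul_left,
      real_inner_smul_left, real_inner_smul_right, real_inner_smul_right, hcc,
      real_inner_comm c (u i)]
    field_simp
    ring
  refine ⟨_, IsPSDKernel.of_inner fun i => (inner ℝ c (u i))⁻¹ • u i - c, fun i => ?_,
    fun i j hij => ?_⟩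
  · rw [key, real_inner_self_eq_norm_sq, hu.1 i]
    have := hr.2 ⟨i, rfl⟩
    have e : (inner ℝ c (u i))⁻¹ * (inner ℝ c (u i))⁻¹ * 1 ^ 2 = 1 / (inner ℝ c (u i)) ^ 2 := by
      rw [one_div, ← inv_pow]; ring
    rw [e]
    linarith
  · rw [key, hu.2 i j hij.ne (by simp [hij])]
    ring

theorem ThetaFeasible.mem_thetaBarValues [Nonempty V] {r : ℝ} (h : ThetaFeasible G (r - 1)) :
    r ∈ thetaBarValues G := by
  have hr : 1 ≤ r := by linarith [h.nonneg]
  obtain ⟨Y, hY, hd, he⟩ := h.exists_diag_eq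
  obtain ⟨m, y, hy⟩ := hY.exists_inner
  let φ := (stdOrthonormalBasis ℝ (WithLp 2 (ℝ × EuclideanSpace ℝ (Fin m)))).repr
  -- Inverse of the passage to `y_i`: the handle is `(1, 0)`, and the padded diagonal gives all `(1,
  -- y_i)` the same norm `√r`.
  let w : V → WithLp 2 (ℝ × EuclideanSpace ℝ (Fin m)) := fun i => (√r)⁻¹ • WithLp.toLp 2 (1, y i)
  let e : WithLp 2 (ℝ × EuclideanSpace ℝ (Fin m)) := WithLp.toLp 2 (1, 0)
  have hs : (√r)⁻¹ * (√r)⁻¹ = r⁻¹ := by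
    rw [← mul_inv, Real.mul_self_sqrt (by linarith)]
  have hs0 : √r ≠ 0 := (Real.sqrt_pos.2 (by linarith)).ne'
  have hww : ∀ i j, inner ℝ (w i) (w j) = r⁻¹ * (1 + Y i j) := by
    intro i j
    simp only [w, real_inner_smul_left, real_inner_smul_right, inner_toLp_pair, hy,
      ← mul_assoc, hs, one_mul]
  have hew : ∀ i, inner ℝ (φ e) (φ (w i)) = (√r)⁻¹ := by
    intro i
    rw [LinearIsometryEquiv.inner_map_map]
    simp [w, e]
  have hval : ∀ i, 1 / (inner ℝ (φ e) (φ (w i))) ^ 2 = r := by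
    intro i
    rw [hew, sq, hs, one_div, inv_inv]
  refine ⟨_, fun i => φ (w i), φ e, ⟨fun i => ?_, fun i j hij hadj => ?_⟩, ?_, fun i => ?_, ?_⟩
  · have : ‖φ (w i)‖ ^ 2 = 1 := by
      rw [LinearIsometryEquiv.norm_map, ← real_inner_self_eq_norm_sq, hww, hd]
      field_simp
      ring
    rwa [pow_eq_one_iff_of_nonneg (norm_nonneg _) two_ne_zero] at this
  · have hG : G.Adj i j := by
      by_contra hn
      exact hadj ((SimpleGraph.compl_adj G i j).2 ⟨hij, hn⟩)
    rw [LinearIsometryEquiv.inner_map_map, hww, he i j hG]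
    ring
  · have : ‖φ e‖ ^ 2 = 1 := by
      rw [LinearIsometryEquiv.norm_map, ← real_inner_self_eq_norm_sq,
        inner_toLp_pair]
      simp
    rwa [pow_eq_one_iff_of_nonneg (norm_nonneg _) two_ne_zero] at this
  · rw [hew]
    exact inv_ne_zero hs0
  · have hc : (fun i => 1 / (inner ℝ (φ e) (φ (w i))) ^ 2) = fun _ => r := funext hval
    rw [hc, Set.range_const]
    exact isGreatest_singleton

theorem mem_thetaBarValues_iff [Nonempty V] {r : ℝ} :
    r ∈ thetaBarValues G ↔ ThetaFeasible G (r - 1) :=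
  ⟨ThetaFeasible.of_mem_thetaBarValues, ThetaFeasible.mem_thetaBarValues⟩

variable (G) in
-- The kernel `n I - J`, with `n` the number of vertices, is PSD by Cauchy–Schwarz.
theorem exists_thetaFeasible : ∃ T, ThetaFeasible G T := by
  classical
  refine ⟨Fintype.card V - 1, fun i j => (if i = j then (Fintype.card V : ℝ) else 0) - 1,
    ⟨fun i j => by simp only [eq_comm], fun x => ?_⟩, fun i => by simp, fun i j h => by simp [h.ne]⟩
  have h := sq_sum_le_card_mul_sum_sq (s := Finset.univ) (f := x)
  rw [Finset.card_univ, sq, Finset.sum_mul_sum] at h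
  simp only [mul_sub, mul_ite, mul_zero, mul_one, Finset.sum_sub_distrib, Finset.sum_ite_eq,
    Finset.mem_univ, if_true, ← Finset.sum_mul]
  simp only [sq] at h
  linarith

variable (G) in
theorem exists_isLeast_thetaFeasible [Nonempty V] : ∃ T, IsLeast {T | ThetaFeasible G T} T := by
  obtain ⟨C, hC⟩ := exists_thetaFeasible G
  have hK : IsCompact ({p : (V → V → ℝ) × ℝ | (∀ i, p.1 i i ≤ p.2) ∧
      (∀ i j, G.Adj i j → p.1 i j = -1)} ∩
      ({Y | IsPSDKernel Y} ∩ {Y | ∀ i, Y i i ≤ C}) ×ˢ Set.Icc 0 C) := by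
    refine IsCompact.inter_left ?_ ?_
    · refine IsCompact.prod ?_ isCompact_Icc
      refine Metric.isCompact_of_isClosed_isBounded ?_ (IsPSDKernel.isBounded_setOf_diag_le C)
      refine IsPSDKernel.isClosed_setOf.inter ?_
      simp only [Set.ofPred_forall]
      exact isClosed_iInter fun i => isClosed_le (by fun_prop) (by fun_prop)
    · rw [Set.ofPred_and]
      simp only [Set.ofPred_forall]
      refine IsClosed.inter ?_ ?_
      · exact isClosed_iInter fun i => isClosed_le (by fun_prop) (by fun_prop)
      · exact isClosed_iInter fun i => isClosed_iInter fun j => isClosed_iInter fun _ =>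
          isClosed_eq (by fun_prop) (by fun_prop)
  obtain ⟨Y₀, hY₀, hd₀, he₀⟩ := id hC
  obtain ⟨⟨Y, T⟩, ⟨⟨hd, he⟩, ⟨hY, -⟩, -⟩, hmin⟩ := hK.exists_isMinOn
    ⟨(Y₀, C), ⟨hd₀, he₀⟩, ⟨hY₀, hd₀⟩, hC.nonneg, le_rfl⟩ continuous_snd.continuousOn
  refine ⟨T, ⟨Y, hY, hd, he⟩, fun S hS => ?_⟩
  rcases le_total S C with hSC | hSC
  · obtain ⟨Z, hZ, hZd, hZe⟩ := id hS
    exact hmin (a := (Z, S)) ⟨⟨hZd, hZe⟩, ⟨hZ, fun i => (hZd i).trans hSC⟩, hS.nonneg, hSC⟩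
  · exact (hmin (a := (Y₀, C)) ⟨⟨hd₀, he₀⟩, ⟨hY₀, hd₀⟩, hC.nonneg, le_rfl⟩).trans hSC

theorem isLeast_thetaBarValues_of_isLeast [Nonempty V] {T : ℝ}
    (hT : IsLeast {T | ThetaFeasible G T} T) : IsLeast (thetaBarValues G) (1 + T) := by
  refine ⟨mem_thetaBarValues_iff.2 (by simpa using hT.1), fun r hr => ?_⟩
  have := hT.2 (mem_thetaBarValues_iff.1 hr)
  linarith

end Feasible

/-! ### Semidefinite duality -/

section Duality

variable {V : Type*} [Fintype V] {G : SimpleGraph V}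

theorem isCompact_setOf_isPSDKernel_sum_diag_eq_one :
    IsCompact {Y : V → V → ℝ | IsPSDKernel Y ∧ ∑ i, Y i i = 1} := by
  refine Metric.isCompact_of_isClosed_isBounded ?_
    ((IsPSDKernel.isBounded_setOf_diag_le 1).subset ?_)
  · exact IsPSDKernel.isClosed_setOf.inter (isClosed_eq (by fun_prop) (by fun_prop))
  · rintro Y ⟨hY, h⟩
    refine ⟨hY, fun i => h ▸ ?_⟩
    exact Finset.single_le_sum (f := fun i => Y i i) (fun i _ => hY.diag_nonneg i)
      (Finset.mem_univ i)

theorem convex_setOf_isPSDKernel_sum_diag_eq_one :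
    Convex ℝ {Y : V → V → ℝ | IsPSDKernel Y ∧ ∑ i, Y i i = 1} := by
  rintro Y ⟨hY, hY1⟩ Z ⟨hZ, hZ1⟩ a b ha hb hab
  refine ⟨(hY.smul ha).add (hZ.smul hb), ?_⟩
  simp [Finset.sum_add_distrib, ← Finset.mul_sum, hY1, hZ1, hab]

/-- Weak duality. -/
theorem ThetaFeasible.sum_le {T : ℝ} (hT : ThetaFeasible G T) {B : V → V → ℝ}
    (hB : IsPSDKernel B) (hs : ∀ i j, i ≠ j → ¬ G.Adj i j → B i j = 0) :
    ∑ i, ∑ j, B i j ≤ (1 + T) * ∑ i, B i i := by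
  classical
  obtain ⟨Y, hY, hd, he⟩ := hT
  obtain ⟨m, y, hy⟩ := hY.exists_inner
  have h := hB.sum_inner_nonneg y
  simp only [← hy] at h
  have h' : ∑ i, ∑ j, B i j * Y i j ≤
      ∑ i, ∑ j, ((if i = j then (1 + T) * B i i else 0) - B i j) := by
    refine Finset.sum_le_sum fun i _ => Finset.sum_le_sum fun j _ => ?_
    by_cases hij : i = j
    · subst hij
      have := mul_le_mul_of_nonneg_left (hd i) (hB.diag_nonneg i)
      simp only [if_true]
      linarith
    · by_cases hG : G.Adj i j
      · simp [hij, he i j hG]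
      · simp [hij, hs i j hij hG]
  simp only [Finset.sum_sub_distrib, Finset.sum_ite_eq, Finset.mem_univ, if_true,
    ← Finset.mul_sum] at h'
  linarith

theorem apply_eq_sum_single [DecidableEq V] (f : StrongDual ℝ (V → V → ℝ)) (Z : V → V → ℝ) :
    f Z = ∑ i, ∑ j, Z i j * f (Pi.single i (Pi.single j 1)) := by
  have h : Z = ∑ i, ∑ j, Z i j • Pi.single (M := fun _ => V → ℝ) i (Pi.single j (1 : ℝ)) := by
    ext a b
    simp [Finset.sum_apply, Pi.single_apply, apply_ite, ite_apply]
  conv_lhs => rw [h]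
  simp only [map_sum, map_smul, smul_eq_mul]

/-- A dual certificate for infeasibility, by separation of the compact base of the PSD cone from
the cone of multiples of the affine constraints. -/
theorem exists_dual_of_not_thetaFeasible {T : ℝ} (hT : ¬ ThetaFeasible G T) {p q : V}
    (hpq : G.Adj p q) :
    ∃ B : V → V → ℝ, IsPSDKernel B ∧ (∀ i j, i ≠ j → ¬ G.Adj i j → B i j = 0) ∧
      0 < ∑ i, B i i ∧ (1 + T) * ∑ i, B i i ≤ ∑ i, ∑ j, B i j := by
  classical
  -- Homogenized constraints: `-Z p q` is the scale, and a PSD member of positive scale becomes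
  -- feasible on division by it.
  let C : Set (V → V → ℝ) := {Z | Z p q ≤ 0 ∧ (∀ i, Z i i ≤ -T * Z p q) ∧
    ∀ i j, G.Adj i j → Z i j = Z p q}
  have hC : Convex ℝ C := by
    rintro Y ⟨hY0, hYd, hYe⟩ Z ⟨hZ0, hZd, hZe⟩ a b ha hb -
    refine ⟨?_, fun i => ?_, fun i j hij => ?_⟩
    · simp only [Pi.add_apply, Pi.smul_apply, smul_eq_mul]
      nlinarith
    · simp only [Pi.add_apply, Pi.smul_apply, smul_eq_mul]
      nlinarith [hYd i, hZd i]
    · simp [hYe i j hij, hZe i j hij]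
  have hCc : IsClosed C := by
    refine IsClosed.inter ?_ (IsClosed.inter ?_ ?_)
    · change IsClosed {Z : V → V → ℝ | Z p q ≤ 0}
      exact isClosed_le (by fun_prop) (by fun_prop)
    · change IsClosed {Z : V → V → ℝ | ∀ i, Z i i ≤ -T * Z p q}
      simp only [Set.ofPred_forall]
      exact isClosed_iInter fun i => isClosed_le (by fun_prop) (by fun_prop)
    · change IsClosed {Z : V → V → ℝ | ∀ i j, G.Adj i j → Z i j = Z p q}
      simp only [Set.ofPred_forall]
      exact isClosed_iInter fun i => isClosed_iInter fun j => isClosed_iInter fun _ =>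
        isClosed_eq (by fun_prop) (by fun_prop)
  have hdisj : Disjoint {Y : V → V → ℝ | IsPSDKernel Y ∧ ∑ i, Y i i = 1} C := by
    rw [Set.disjoint_left]
    rintro Z ⟨hZ, hZ1⟩ ⟨h0, hd, he⟩
    rcases h0.eq_or_lt with h0 | h0
    · have : ∑ i, Z i i ≤ 0 := Finset.sum_nonpos fun i _ => by simpa [h0] using hd i
      linarith
    · refine hT ⟨_, hZ.smul (c := (-Z p q)⁻¹) (by simpa using h0.le), fun i => ?_,
        fun i j hij => ?_⟩
      · rw [inv_mul_le_iff₀ (by linarith)]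
        linarith [hd i]
      · rw [he i j hij, inv_neg, neg_mul, inv_mul_cancel₀ h0.ne]
  obtain ⟨f, a, b, hfa, hab, hfb⟩ := geometric_hahn_banach_compact_closed
    convex_setOf_isPSDKernel_sum_diag_eq_one isCompact_setOf_isPSDKernel_sum_diag_eq_one hC hCc
    hdisj
  have hb : b < 0 := by
    have := hfb 0 ⟨le_rfl, by simp, by simp⟩
    simpa using this
  have hsmul : ∀ Z ∈ C, ∀ c : ℝ, 0 ≤ c → c • Z ∈ C := by
    rintro Z ⟨h0, hd, he⟩ c hc
    refine ⟨?_, fun i => ?_, fun i j hij => ?_⟩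
    · simp only [Pi.smul_apply, smul_eq_mul]
      nlinarith
    · simp only [Pi.smul_apply, smul_eq_mul]
      nlinarith [hd i]
    · simp [he i j hij]
  have hfC : ∀ Z ∈ C, 0 ≤ f Z := by
    intro Z hZ
    by_contra! hneg
    have h := hfb _ (hsmul Z hZ (b / f Z) (div_nonneg_of_nonpos hb.le hneg.le))
    rw [map_smul, smul_eq_mul, div_mul_cancel₀ _ hneg.ne] at h
    exact lt_irrefl _ h
  let F : V → V → ℝ := fun i j => f (Pi.single i (Pi.single j 1))
  have hF : ∀ Z, f Z = ∑ i, ∑ j, Z i j * F i j := apply_eq_sum_single f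
  have hfpsd : ∀ Z : V → V → ℝ, IsPSDKernel Z → 0 < ∑ i, Z i i → f Z < 0 := by
    intro Z hZ hpos
    have h := hfa _ ⟨hZ.smul (inv_nonneg.2 hpos.le), by
      rw [← Finset.mul_sum, inv_mul_cancel₀ hpos.ne']⟩
    have e : (fun i j => (∑ i, Z i i)⁻¹ * Z i j) = (∑ i, Z i i)⁻¹ • Z := rfl
    rw [e, map_smul, smul_eq_mul] at h
    by_contra! hn
    have := mul_nonneg (inv_nonneg.2 hpos.le) hn
    linarith
  have hrank : ∀ x : V → ℝ, x ≠ 0 → ∑ i, ∑ j, x i * x j * F i j < 0 := by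
    intro x hx
    obtain ⟨k, hk⟩ := Function.ne_iff.1 hx
    rw [← hF fun i j => x i * x j]
    refine hfpsd _ ?_ ?_
    · simpa [mul_comm] using IsPSDKernel.of_inner x
    · exact Finset.sum_pos' (fun i _ => mul_self_nonneg _)
        ⟨k, Finset.mem_univ k, mul_self_pos.2 hk⟩
  have hsupp : ∀ i j, i ≠ j → ¬ G.Adj i j → F i j = 0 := by
    intro i j hij hG
    -- Off the diagonal and the edges no constraint applies, so matrix units of both signs lie in
    -- `C`.
    have hmem : ∀ c : ℝ, (Pi.single i (Pi.single j c) : V → V → ℝ) ∈ C := by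
      intro c
      have hz : ∀ k l, (k, l) ≠ (i, j) → (Pi.single i (Pi.single j c) : V → V → ℝ) k l = 0 := by
        intro k l hkl
        by_cases hk : k = i
        · subst hk
          have : l ≠ j := fun h => hkl (by rw [h])
          simp [this]
        · simp [hk]
      have hpq0 := hz p q (by rintro ⟨⟩; exact hG hpq)
      refine ⟨hpq0.le, fun k => ?_, fun k l hkl => ?_⟩
      · rw [hpq0, hz k k (by rintro ⟨⟩; exact hij rfl)]
        simp
      · rw [hpq0, hz k l (by rintro ⟨⟩; exact hG hkl)]
    have h₁ := hfC _ (hmem 1)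
    have h₂ := hfC _ (hmem (-1))
    have e : (Pi.single i (Pi.single j (-1)) : V → V → ℝ) = -Pi.single i (Pi.single j 1) := by
      rw [← Pi.single_neg, ← Pi.single_neg]
    rw [e, map_neg] at h₂
    change 0 ≤ F i j at h₁
    change 0 ≤ -F i j at h₂
    linarith
  have hdiag : ∀ i, F i i < 0 := by
    intro i
    have := hrank (Pi.single i 1) (by simp)
    simpa [Pi.single_apply] using this
  -- The test kernel lies in `C` whether or not it is PSD; the sign of `f` on it is the objective
  -- inequality.
  have hP : 0 ≤ ∑ i, ∑ j, (if i = j then T else if G.Adj i j then -1 else 0) * F i j := by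
    rw [← hF fun i j => if i = j then T else if G.Adj i j then -1 else 0]
    refine hfC _ ⟨?_, fun i => ?_, fun i j hij => ?_⟩
    · simp [hpq.ne, hpq]
    · simp [hpq.ne, hpq]
    · simp [hpq.ne, hpq, hij.ne, hij]
  have hP' : ∑ i, ∑ j, (if i = j then T else if G.Adj i j then -1 else 0) * F i j =
      (1 + T) * ∑ i, F i i - ∑ i, ∑ j, F i j := by
    have h : ∀ i j, (if i = j then T else if G.Adj i j then -1 else 0) * F i j =
        (if i = j then (1 + T) * F i i else 0) - F i j := by
      intro i j
      by_cases hij : i = j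
      · subst hij
        simp only [if_true]
        ring
      · by_cases hG : G.Adj i j
        · simp [hij, hG]
        · simp [hij, hG, hsupp i j hij hG]
    simp only [h, Finset.sum_sub_distrib, Finset.sum_ite_eq, Finset.mem_univ, if_true,
      Finset.mul_sum]
  have hswap : ∀ x : V → ℝ, ∑ i, ∑ j, x i * x j * F j i = ∑ i, ∑ j, x i * x j * F i j := by
    intro x
    rw [Finset.sum_comm]
    exact Finset.sum_congr rfl fun i _ => Finset.sum_congr rfl fun j _ => by ring
  have hsum : ∀ x : V → ℝ, ∑ i, ∑ j, x i * x j * (-(F i j + F j i) / 2) =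
      -∑ i, ∑ j, x i * x j * F i j := by
    intro x
    have h : ∑ i, ∑ j, x i * x j * (-(F i j + F j i) / 2) =
        -(∑ i, ∑ j, x i * x j * F i j + ∑ i, ∑ j, x i * x j * F j i) / 2 := by
      rw [← Finset.sum_add_distrib, ← Finset.sum_neg_distrib, Finset.sum_div]
      refine Finset.sum_congr rfl fun i _ => ?_
      rw [← Finset.sum_add_distrib, ← Finset.sum_neg_distrib, Finset.sum_div]
      exact Finset.sum_congr rfl fun j _ => by ring
    rw [h, hswap]
    ring
  have htr : ∑ i, -(F i i + F i i) / 2 = -∑ i, F i i := by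
    rw [← Finset.sum_neg_distrib]
    exact Finset.sum_congr rfl fun i _ => by ring
  -- `F` is negative definite as a form but need not be symmetric.
  refine ⟨fun i j => -(F i j + F j i) / 2, ⟨fun i j => by ring, fun x => ?_⟩, fun i j hij hG => ?_,
    ?_, ?_⟩
  · rw [hsum]
    by_cases hx : x = 0
    · simp [hx]
    · linarith [hrank x hx]
  · beta_reduce
    rw [hsupp i j hij hG, hsupp j i hij.symm fun h => hG h.symm]
    simp
  · rw [htr]
    have := Finset.sum_neg (fun i _ => hdiag i) (⟨p, Finset.mem_univ p⟩ : Finset.univ.Nonempty)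
    linarith
  · have h := hsum fun _ => 1
    simp only [one_mul] at h
    rw [htr, h]
    linarith

/-- Strong duality: a dual optimal kernel `B`, with the eigenvalue relations that express
complementary slackness. -/
theorem exists_dual_optimal [DecidableEq V] {T : ℝ} (hT : IsLeast {T | ThetaFeasible G T} T)
    {p q : V} (hpq : G.Adj p q) :
    ∃ B : V → V → ℝ, IsPSDKernel B ∧ (∀ i j, i ≠ j → ¬ G.Adj i j → B i j = 0) ∧
      ∑ i, B i i = 1 ∧
      IsPSDKernel (fun i j => (if i = j then (1 + T) * B i i else 0) - B i j) ∧
      ∀ j, ∑ i, B i j = (1 + T) * B j j := by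
  have hK : IsCompact ({B : V → V → ℝ | IsPSDKernel B ∧ ∑ i, B i i = 1} ∩
      {B | ∀ i j, i ≠ j → ¬ G.Adj i j → B i j = 0}) := by
    refine isCompact_setOf_isPSDKernel_sum_diag_eq_one.inter_right ?_
    simp only [Set.ofPred_forall]
    exact isClosed_iInter fun i => isClosed_iInter fun j => isClosed_iInter fun _ =>
      isClosed_iInter fun _ => isClosed_eq (by fun_prop) (by fun_prop)
  have hbelow : ∀ S < T, ∃ B ∈ {B : V → V → ℝ | IsPSDKernel B ∧ ∑ i, B i i = 1} ∩
      {B | ∀ i j, i ≠ j → ¬ G.Adj i j → B i j = 0}, 1 + S ≤ ∑ i, ∑ j, B i j := by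
    intro S hS
    obtain ⟨B, hB, hs, hpos, hle⟩ :=
      exists_dual_of_not_thetaFeasible (fun h => hS.not_ge (hT.2 h)) hpq
    refine ⟨fun i j => (∑ i, B i i)⁻¹ * B i j, ⟨⟨hB.smul (inv_nonneg.2 hpos.le), ?_⟩, ?_⟩, ?_⟩
    · rw [← Finset.mul_sum, inv_mul_cancel₀ hpos.ne']
    · intro i j hij hG
      simp [hs i j hij hG]
    · simp only [← Finset.mul_sum]
      rw [le_inv_mul_iff₀ hpos]
      linarith
  obtain ⟨B₀, hB₀, -⟩ := hbelow (T - 1) (by linarith)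
  obtain ⟨B, ⟨⟨hB, hB1⟩, hs⟩, hmax⟩ := hK.exists_isMaxOn ⟨B₀, hB₀⟩
    (f := fun B => ∑ i, ∑ j, B i j) (by fun_prop)
  have hge : 1 + T ≤ ∑ i, ∑ j, B i j := by
    by_contra! hlt
    obtain ⟨S, hS₁, hS₂⟩ := exists_between (sub_lt_iff_lt_add'.2 hlt)
    obtain ⟨B', hB', hle⟩ := hbelow S hS₂
    have := hmax hB'
    simp only [Set.mem_ofPred_eq] at this
    linarith
  -- The rescaled kernel `x i * x j * B i j` has the same support, and weak duality for it is
  -- nonnegativity of this form at `x`.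
  have hF : IsPSDKernel (fun i j => (if i = j then (1 + T) * B i i else 0) - B i j) := by
    refine ⟨fun i j => ?_, fun x => ?_⟩
    · by_cases h : i = j
      · subst h; rfl
      · simp [h, Ne.symm h, hB.symm i j]
    · have h := hT.1.sum_le (hB.scale x) fun i j hij hG => by rw [hs i j hij hG, mul_zero]
      simp only [mul_sub, mul_ite, mul_zero, Finset.sum_sub_distrib, Finset.sum_ite_eq,
        Finset.mem_univ, if_true]
      rw [Finset.mul_sum] at h
      refine sub_nonneg.2 (h.trans_eq (Finset.sum_congr rfl fun i _ => by ring))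
  refine ⟨B, hB, hs, hB1, hF, fun j => ?_⟩
  obtain ⟨m, y, hy⟩ := hF.exists_inner
  -- The form of the slack kernel at the all-ones vector is `1 + T - ∑ B ≤ 0`, so that vector lies
  -- in its kernel.
  have h0 : ∑ i, y i = 0 := by
    rw [← inner_self_eq_zero (𝕜 := ℝ)]
    refine le_antisymm ?_ real_inner_self_nonneg
    simp only [sum_inner, inner_sum, ← hy, Finset.sum_sub_distrib, Finset.sum_ite_eq', Finset.mem_univ, if_true, ← Finset.mul_sum, hB1]
    rw [Finset.sum_comm]
    linarith
  have h1 : ∑ i, inner ℝ (y i) (y j) = 0 := by rw [← sum_inner, h0, inner_zero_left]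
  simp only [← hy, Finset.sum_sub_distrib, Finset.sum_ite_eq', Finset.mem_univ, if_true] at h1
  linarith

end Duality

/-! ### The cubic and its largest root -/

section Cubic

/-- The substitution `x = u + 1` brings the cubic into the form `(u + t)² (t - u) = 4 t (t - 1)`. -/
theorem mycielskian_cubic_iff (t x : ℝ) :
    x ^ 3 + (t - 3) * x ^ 2 + (3 - 2 * t - t ^ 2) * x + (-t ^ 3 + 5 * t ^ 2 - 3 * t - 1) = 0 ↔
      (x - 1 + t) ^ 2 * (t - (x - 1)) = 4 * t * (t - 1) := by
  constructor <;> intro h <;> linear_combination -h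

/-- For `u = (4 c - 1) t / 3` with `c = cos φ`, the left side is `16 t³ / 27 * (1 - cos 3φ)`. Since
`φ ≤ π / 3`, one has `c ≥ 1 / 2`, which is the branch `u ≥ t / 3`. -/
theorem cubic_trigonometric_root {t : ℝ} (ht : 1 ≤ t) {u : ℝ}
    (hu : u = 4 / 3 * t * Real.cos (1 / 3 * Real.arccos (1 - 27 / (4 * t) + 27 / (4 * t ^ 2))) -
      1 / 3 * t) :
    (u + t) ^ 2 * (t - u) = 4 * t * (t - 1) ∧ t / 3 ≤ u ∧ u ≤ t := by
  have ht0 : t ≠ 0 := by linarith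
  set a : ℝ := 1 - 27 / (4 * t) + 27 / (4 * t ^ 2) with ha
  have ha' : a * (4 * t ^ 2) = 4 * t ^ 2 - 27 * t + 27 := by
    rw [ha]; field_simp
  have ht2 : 0 < 4 * t ^ 2 := by positivity
  have ha1 : a ≤ 1 := by
    by_contra! h
    nlinarith
  have ha2 : -1 ≤ a := by
    by_contra! h
    -- The claim is `8 t² - 27 t + 27 ≥ 0`; the square completes it.
    nlinarith [sq_nonneg (16 * t - 27)]
  set φ : ℝ := 1 / 3 * Real.arccos a with hφ
  have h3 : Real.cos (3 * φ) = a := by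
    rw [hφ, ← mul_assoc]
    norm_num [Real.cos_arccos ha2 ha1]
  rw [Real.cos_three_mul] at h3
  have hφ0 : 0 ≤ φ := by
    have := Real.arccos_nonneg a
    rw [hφ]; linarith
  have hφ1 : φ ≤ Real.pi / 3 := by
    have := Real.arccos_le_pi a
    rw [hφ]; linarith
  have hc : 1 / 2 ≤ Real.cos φ := by
    rw [← Real.cos_pi_div_three]
    exact Real.cos_le_cos_of_nonneg_of_le_pi hφ0 (by linarith [Real.pi_pos]) hφ1
  have hc1 := Real.cos_le_one φ
  set c := Real.cos φ
  refine ⟨?_, ?_, ?_⟩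
  · have : a * (4 * t ^ 2) * t = (4 * t ^ 2 - 27 * t + 27) * t := by rw [ha']
    rw [← h3] at this
    rw [hu]
    linear_combination (-4 / 27) * this
  · rw [hu]; nlinarith
  · rw [hu]; nlinarith

/-- The form has derivative `(w + t) (t - 3 w)` in `w`, so it decreases beyond `t / 3`. -/
theorem cubic_form_le {t u w : ℝ} (ht : 1 ≤ t) (hu : t / 3 ≤ u) (huw : u ≤ w) :
    (w + t) ^ 2 * (t - w) ≤ (u + t) ^ 2 * (t - u) := by
  have h : (u + t) ^ 2 * (t - u) - (w + t) ^ 2 * (t - w) =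
      (w - u) * (w ^ 2 + w * u + u ^ 2 + t * (w + u) - t ^ 2) := by ring
  have h2 : 0 ≤ w ^ 2 + w * u + u ^ 2 + t * (w + u) - t ^ 2 := by nlinarith
  have := mul_nonneg (sub_nonneg.2 huw) h2
  linarith

theorem cubic_root_le {t u w : ℝ} (ht : 1 ≤ t) (hu : t / 3 ≤ u)
    (h : (u + t) ^ 2 * (t - u) = 4 * t * (t - 1)) (hw : (w + t) ^ 2 * (t - w) = 4 * t * (t - 1)) :
    w ≤ u := by
  by_contra! huw
  have e : (w - u) * (w ^ 2 + w * u + u ^ 2 + t * (w + u) - t ^ 2) = 0 := by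
    linear_combination h - hw
  have h2 : 0 < w ^ 2 + w * u + u ^ 2 + t * (w + u) - t ^ 2 := by nlinarith
  have := mul_pos (sub_pos.2 huw) h2
  linarith

/-- At `t - 1` the form equals `(2 t - 1)² = 4 t (t - 1) + 1`, above its value at the root. -/
theorem sub_one_lt_of_cubic {t u : ℝ} (ht : 1 ≤ t) (hu : t / 3 ≤ u)
    (h : (u + t) ^ 2 * (t - u) = 4 * t * (t - 1)) : t - 1 < u := by
  by_contra! hle
  have := cubic_form_le ht hu hle
  nlinarith

theorem cubic_defect {t u : ℝ} (h : (u + t) ^ 2 * (t - u) = 4 * t * (t - 1)) :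
    4 * t * (u + 1 - t) * (u - 1) = (t - u) ^ 3 := by
  linear_combination -h

theorem one_le_of_cubic {t u : ℝ} (ht : 1 ≤ t) (hu : t / 3 ≤ u) (hut : u ≤ t)
    (h : (u + t) ^ 2 * (t - u) = 4 * t * (t - 1)) : 1 ≤ u := by
  have h1 := sub_one_lt_of_cubic ht hu h
  have h2 := cubic_defect h
  have h3 : 0 ≤ (t - u) ^ 3 := pow_nonneg (by linarith) 3
  have h4 : 0 < 4 * t * (u + 1 - t) := mul_pos (by linarith) (by linarith)
  by_contra! hlt
  nlinarith

/-- The geometric mean of `t u` and `u + 1 - t` is rational in `t` and `u` at a root. -/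
theorem cubic_geometric_mean {t u : ℝ} (h : (u + t) ^ 2 * (t - u) = 4 * t * (t - 1)) :
    ((u ^ 2 - t ^ 2 + 2 * t) / 2) ^ 2 = t * u * (u + 1 - t) := by
  linear_combination (t - u) / 4 * h

theorem cubic_mean_pos {t u : ℝ} (ht : 1 ≤ t) (hu : t / 3 ≤ u)
    (h : (u + t) ^ 2 * (t - u) = 4 * t * (t - 1)) : 0 < (u ^ 2 - t ^ 2 + 2 * t) / 2 := by
  have := sub_one_lt_of_cubic ht hu h
  nlinarith

/-- Equivalent to `2 (t - u)² < 4 t (t - 1)`; it makes the parameter `r` positive. -/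
theorem cubic_mean_lt {t u : ℝ} (ht : 1 < t) (hu : t / 3 ≤ u) (hut : u ≤ t)
    (h : (u + t) ^ 2 * (t - u) = 4 * t * (t - 1)) : (u ^ 2 - t ^ 2 + 2 * t) / 2 < t * u := by
  have hlt : 0 < t - u := by
    refine lt_of_le_of_ne (by linarith) fun h0 => ?_
    rw [← h0] at h
    nlinarith
  have h1 : (4 * t / 3) * (2 * (t - u)) ≤ (u + t) ^ 2 := by nlinarith
  have h2 : 2 * (t - u) < (u + t) ^ 2 := by nlinarith
  have h3 : 2 * (t - u) * (t - u) < (u + t) ^ 2 * (t - u) := mul_lt_mul_of_pos_right h2 hlt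
  nlinarith

/-- Becomes `u² (1 - r) ≤ 1`, which makes the weight `η` in `le_of_dual_inequalities` nonnegative.
-/
theorem mul_cubic_mean_le {t u : ℝ} (ht : 1 ≤ t) (hu : t / 3 ≤ u) (hut : u ≤ t)
    (h : (u + t) ^ 2 * (t - u) = 4 * t * (t - 1)) : u * ((u ^ 2 - t ^ 2 + 2 * t) / 2) ≤ t := by
  have h1 := sub_one_lt_of_cubic ht hu h
  have h2 := cubic_defect h
  set d := t - u with hd
  have hd0 : 0 ≤ d := by linarith
  have hd1 : d < 1 := by linarith
  have e : u * ((u ^ 2 - t ^ 2 + 2 * t) / 2) = t - d * t + d ^ 3 / 4 + u * d ^ 2 / 2 := by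
    rw [← h2, hd]; ring
  rw [e]
  have h3 : d ^ 2 / 4 + u * d / 2 ≤ t := by nlinarith
  nlinarith

end Cubic

/-! ### Upper bound for the Mycielskian -/

section Mycielskian

/-- At a root of the cubic the small semidefinite programs that remain after block
diagonalization have a rational solution, given by one parameter `r`. -/
theorem exists_cubic_param {t u : ℝ} (ht : 1 ≤ t) (hu : t / 3 ≤ u) (hut : u ≤ t)
    (h : (u + t) ^ 2 * (t - u) = 4 * t * (t - 1)) :
    ∃ r : ℝ, r ^ 2 * (t - 1) * t * u = (u + 1) * (u ^ 2 - 1) ∧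
      u * (1 - r) ^ 2 * t = u + 1 - t ∧ r < 1 ∧ (1 < t → 0 < r) ∧ u ^ 2 * (1 - r) ≤ 1 := by
  have hu1 := one_le_of_cubic ht hu hut h
  have hM := cubic_geometric_mean h
  have hM0 := cubic_mean_pos ht hu h
  have hM1 := mul_cubic_mean_le ht hu hut h
  have hM2 := fun ht' : 1 < t => cubic_mean_lt ht' hu hut h
  have hMdef : 2 * ((u ^ 2 - t ^ 2 + 2 * t) / 2) = u ^ 2 - t ^ 2 + 2 * t := by ring
  set M := (u ^ 2 - t ^ 2 + 2 * t) / 2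
  have ht0 : 0 < t := by linarith
  have hu0 : 0 < u := by linarith
  have htu : 0 < t * u := mul_pos ht0 hu0
  have hr : ∀ s : ℝ, s = 1 - M / (t * u) → t * u * s = t * u - M := by
    rintro s rfl
    field_simp
  refine ⟨1 - M / (t * u), ?_, ?_, ?_, fun ht' => ?_, ?_⟩
  · have := hr _ rfl
    set s := 1 - M / (t * u)
    have e : (t * u * s) ^ 2 = (t * u - M) ^ 2 := by rw [this]
    refine mul_left_cancel₀ htu.ne' ?_
    linear_combination (t - 1) * e + (t - 1) * hM - (t - 1) * t * u * hMdef + t * u * h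
  · rw [sub_sub_cancel]
    field_simp
    linear_combination hM
  · have := div_pos hM0 htu
    linarith
  · rw [sub_pos, div_lt_one htu]
    exact hM2 ht'
  · rw [sub_sub_cancel]
    have e : u ^ 2 * (M / (t * u)) = u * M / t := by field_simp
    rw [e, div_le_one ht0]
    exact hM1

variable {V : Type*} [Fintype V] {G : SimpleGraph V}

/-- The vectors are `a_v = (√u (1 - r), μ y_v)`, `b_v = (-1/√u, (r/μ) y_v)` and `z = (√u, 0)`. The
choice `μ² = (u + 1) / t` and the second equation for `r` settle the products among the `a_v`; the
first puts the diagonal of `b` at `u`; and `(1 - r) + r = 1` settles the mixed edges. -/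
theorem thetaFeasible_mycielskian {t u : ℝ} (ht : 1 ≤ t) (hu : t / 3 ≤ u) (hut : u ≤ t)
    (h : (u + t) ^ 2 * (t - u) = 4 * t * (t - 1)) (hT : ThetaFeasible G (t - 1)) :
    ThetaFeasible (mycielskian G) u := by
  obtain ⟨r, h1, h2, -, -, -⟩ := exists_cubic_param ht hu hut h
  have hu1 := one_le_of_cubic ht hu hut h
  obtain ⟨Y, hY, hd, he⟩ := hT.exists_diag_eq
  obtain ⟨m, y, hy⟩ := hY.exists_inner
  have ht0 : 0 < t := by linarith
  have hu0 : 0 < u := by linarith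
  have hk : √u * √u = u := Real.mul_self_sqrt hu0.le
  have hk0 : √u ≠ 0 := (Real.sqrt_pos.2 hu0).ne'
  have hκ : 0 < (u + 1) / t := div_pos (by linarith) ht0
  have hμ : √((u + 1) / t) * √((u + 1) / t) = (u + 1) / t := Real.mul_self_sqrt hκ.le
  have hμ0 : √((u + 1) / t) ≠ 0 := (Real.sqrt_pos.2 hκ).ne'
  set k := √u
  set μ := √((u + 1) / t)
  have h2' : u * (1 - r) ^ 2 = (u + 1) / t - 1 := by
    field_simp
    linear_combination h2
  have hμt : μ * μ * t = u + 1 := by rw [hμ]; field_simp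
  have haa : ∀ s : ℝ, k * (1 - r) * (k * (1 - r)) + μ * (μ * s) = μ * μ * (1 + s) - 1 := by
    intro s
    linear_combination (1 - r) ^ 2 * hk + h2' - hμ
  have hbb : -k⁻¹ * -k⁻¹ + r / μ * (r / μ * (t - 1)) = u := by
    have e1 : -k⁻¹ * -k⁻¹ = u⁻¹ := by rw [neg_mul_neg, ← mul_inv, hk]
    have e2 : r / μ * (r / μ * (t - 1)) = r ^ 2 * (t - 1) / (μ * μ) := by ring
    rw [e1, e2, hμ]
    field_simp
    linear_combination h1
  have hab : k * (1 - r) * -k⁻¹ + r / μ * (μ * (-1)) = -1 := by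
    field_simp
    ring
  let a : V → WithLp 2 (ℝ × EuclideanSpace ℝ (Fin m)) := fun v =>
    WithLp.toLp 2 (k * (1 - r), μ • y v)
  let b : V → WithLp 2 (ℝ × EuclideanSpace ℝ (Fin m)) := fun v =>
    WithLp.toLp 2 (-k⁻¹, (r / μ) • y v)
  let x : (V × Fin 2) ⊕ Unit → WithLp 2 (ℝ × EuclideanSpace ℝ (Fin m)) :=
    Sum.elim (fun p => if p.2 = 0 then a p.1 else b p.1) fun _ => WithLp.toLp 2 (k, 0)
  have hxx : ∀ v w, G.Adj v w → inner ℝ (a v) (a w) = -1 := by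
    intro v w hvw
    simp only [a, inner_toLp_pair, real_inner_smul_left, real_inner_smul_right, ← hy, he v w hvw]
    rw [haa]
    ring
  have hxy : ∀ v w, G.Adj v w → inner ℝ (a v) (b w) = -1 := by
    intro v w hvw
    simp only [a, b, inner_toLp_pair, real_inner_smul_left, real_inner_smul_right, ← hy,
      he v w hvw]
    exact hab
  have hyz : ∀ v, inner ℝ (b v) (WithLp.toLp 2 (k, 0)) = -1 := by
    intro v
    simp only [b, inner_toLp_pair, inner_zero_right]
    field_simp
    ring
  refine ⟨_, IsPSDKernel.of_inner x, ?_, ?_⟩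
  · rintro (⟨v, i⟩ | z)
    · fin_cases i
      · simp only [x, a, Sum.elim_inl, Fin.zero_eta, if_true, inner_toLp_pair,
          real_inner_smul_left, real_inner_smul_right, ← hy, hd]
        rw [haa]
        linarith
      · simp only [x, b, Sum.elim_inl, Fin.mk_one, one_ne_zero, if_false, inner_toLp_pair,
          real_inner_smul_left, real_inner_smul_right, ← hy, hd]
        rw [hbb]
    · simp only [x, Sum.elim_inr, inner_toLp_pair, inner_zero_right, hk, add_zero, le_refl]
  · rintro (⟨v, i⟩ | z) (⟨w, j⟩ | z') hadj
    · obtain ⟨hvw, hij⟩ := hadj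
      simp only [x, Sum.elim_inl]
      by_cases hi : i = 0
      · by_cases hj : j = 0
        · simpa [hi, hj] using hxx v w hvw
        · simpa [hi, hj] using hxy v w hvw
      · have hj : j = 0 := hij.resolve_left hi
        rw [real_inner_comm]
        simpa [hi, hj] using hxy w v hvw.symm
    · have hi : i = 1 := hadj
      simpa [x, hi] using hyz v
    · have hj : j = 1 := hadj
      rw [real_inner_comm]
      simpa [x, hj] using hyz w
    · exact hadj.elim

/-! ### Lower bound for the Mycielskian -/

/-- Expansion of the nonnegativity of a PSD kernel at a linear combination of two families. -/
theorem IsPSDKernel.combination_nonneg {B : V → V → ℝ} (hB : IsPSDKernel B) {m : ℕ}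
    (x y : V → EuclideanSpace ℝ (Fin m)) (a b : ℝ) :
    0 ≤ a ^ 2 * ∑ i, ∑ j, B i j * inner ℝ (x i) (x j) +
      2 * a * b * ∑ i, ∑ j, B i j * inner ℝ (x i) (y j) +
      b ^ 2 * ∑ i, ∑ j, B i j * inner ℝ (y i) (y j) := by
  have h := hB.sum_inner_nonneg fun i => a • x i + b • y i
  have hs : ∑ i, ∑ j, B i j * inner ℝ (y i) (x j) = ∑ i, ∑ j, B i j * inner ℝ (x i) (y j) := by
    rw [Finset.sum_comm]
    refine Finset.sum_congr rfl fun i _ => Finset.sum_congr rfl fun j _ => ?_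
    rw [hB.symm, real_inner_comm]
  have e : ∑ i, ∑ j, B i j * inner ℝ (a • x i + b • y i) (a • x j + b • y j) =
      a ^ 2 * ∑ i, ∑ j, B i j * inner ℝ (x i) (x j) +
      a * b * ∑ i, ∑ j, B i j * inner ℝ (x i) (y j) +
      a * b * ∑ i, ∑ j, B i j * inner ℝ (y i) (x j) +
      b ^ 2 * ∑ i, ∑ j, B i j * inner ℝ (y i) (y j) := by
    simp only [Finset.mul_sum, ← Finset.sum_add_distrib]
    refine Finset.sum_congr rfl fun i _ => Finset.sum_congr rfl fun j _ => ?_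
    simp only [inner_add_left, inner_add_right, real_inner_smul_left, real_inner_smul_right]
    ring
  rw [e, hs] at h
  linarith

theorem sum_mul_inner_of_adj [DecidableEq V] {B : V → V → ℝ}
    (hs : ∀ i j, i ≠ j → ¬ G.Adj i j → B i j = 0) {m : ℕ} {x y : V → EuclideanSpace ℝ (Fin m)}
    (h : ∀ i j, G.Adj i j → inner ℝ (x i) (y j) = -1) :
    ∑ i, ∑ j, B i j * inner ℝ (x i) (y j) =
      ∑ i, B i i * inner ℝ (x i) (y i) + ∑ i, B i i - ∑ i, ∑ j, B i j := by
  have e : ∀ i j, B i j * inner ℝ (x i) (y j) =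
      (if i = j then B i i * inner ℝ (x i) (y i) + B i i else 0) - B i j := by
    intro i j
    by_cases hij : i = j
    · subst hij
      simp
    · by_cases hG : G.Adj i j
      · simp [hij, h i j hG]
      · simp [hij, hs i j hij hG]
  rw [Finset.sum_congr rfl fun i _ => Finset.sum_congr rfl fun j _ => e i j]
  simp only [Finset.sum_sub_distrib, Finset.sum_ite_eq, Finset.mem_univ, if_true,
    Finset.sum_add_distrib]

/-- The weighted combination of the three scalar inequalities obtained from a feasible kernel of
the Mycielskian and an optimal dual kernel of the graph. -/
theorem le_of_dual_inequalities {t u r σ Xaa Xab Xbb Qbb : ℝ} (ht : 1 < t) (hu : 1 ≤ u)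
    (h1 : r ^ 2 * (t - 1) * t * u = (u + 1) * (u ^ 2 - 1))
    (h2 : u * (1 - r) ^ 2 * t = u + 1 - t) (hr1 : r < 1) (hr0 : 0 < r)
    (hr2 : u ^ 2 * (1 - r) ≤ 1) (haa : Xaa ≤ σ) (hbb : Xbb ≤ σ)
    (i1 : 0 ≤ ((u + 1) / t) ^ 2 * (t * Xbb - Qbb) +
      2 * ((u + 1) / t) * (-r) * (t * Xab - (Xab + 1 - t)) +
      (-r) ^ 2 * (t * Xaa - (Xaa + 1 - t)))
    (i2 : 0 ≤ 1 ^ 2 * (Xaa + 1 - t) + 2 * 1 * (u * (1 - r)) * (Xab + 1 - t) +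
      (u * (1 - r)) ^ 2 * Qbb)
    (i3 : 0 ≤ u ^ 2 * (Qbb / t) - 2 * u + σ) : u ≤ σ := by
  have ht0 : 0 < t := by linarith
  have hu0 : 0 < u := by linarith
  have hm : 0 < u * (1 - r) := mul_pos hu0 (by linarith)
  have hκ : 0 < (u + 1) / t := div_pos (by linarith) ht0
  have hκt : (u + 1) / t * t = u + 1 := by field_simp
  set κ := (u + 1) / t
  set m := u * (1 - r) with hmdef
  -- The inequalities `i1`, `i2`, `i3` get the weights `1 / κ`, `D` and `t η / u²`, chosen so that
  -- `Xab` and `Qbb` cancel.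
  set A := r ^ 2 * (t - 1) / κ with hA
  set D := r * (t - 1) / m with hD
  set η := κ - r * (t - 1) * m with hη
  have hAκ : A * κ = r ^ 2 * (t - 1) := by rw [hA]; field_simp
  have hDm : D * m = r * (t - 1) := by rw [hD]; field_simp
  have hD0 : 0 < D := div_pos (mul_pos hr0 (by linarith)) hm
  have hA0 : 0 < A := div_pos (mul_pos (by positivity) (by linarith)) hκ
  have hη0 : 0 ≤ η := by
    have e : η * (t * r * u) = (u + 1) * u * (1 - u ^ 2 * (1 - r)) := by
      rw [hη, hmdef]
      linear_combination r * u * hκt - u * (1 - r) * h1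
    have : 0 ≤ η * (t * r * u) := by
      rw [e]
      exact mul_nonneg (by positivity) (by linarith)
    exact nonneg_of_mul_nonneg_left this (by positivity)
  have hAu : A * u = u ^ 2 - 1 := by
    refine mul_left_cancel₀ (show u + 1 ≠ 0 by linarith) ?_
    rw [← h1, ← hκt]
    linear_combination t * u * hAκ
  have hDu : D * (u + 1 - t) = r * (t - 1) * t * (1 - r) := by
    rw [← h2]
    linear_combination (1 - r) * t * hDm
  have j1 : 0 ≤ κ * (t * Xbb - Qbb) - 2 * r * (t - 1) * (Xab + 1) + A * (Xaa + 1) := by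
    refine nonneg_of_mul_nonneg_left (i1.trans_eq ?_) hκ
    linear_combination -(Xaa + 1) * hAκ
  have j2 : 0 ≤ D * (Xaa + 1 - t) + 2 * (r * (t - 1)) * (Xab + 1 - t) +
      r * (t - 1) * m * Qbb := by
    refine (mul_nonneg hD0.le i2).trans_eq ?_
    linear_combination (2 * (Xab + 1 - t) + m * Qbb) * hDm
  have j3 : 0 ≤ η * Qbb + t * η / u ^ 2 * (σ - 2 * u) := by
    refine (mul_nonneg (show 0 ≤ t * η / u ^ 2 by positivity) i3).trans_eq ?_
    field_simp
    ring
  have j4 : 0 ≤ (A + D) * (σ - Xaa) := mul_nonneg (by positivity) (by linarith)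
  have j5 : 0 ≤ κ * t * (σ - Xbb) := mul_nonneg (by positivity) (by linarith)
  have hsum : 0 ≤ A * (σ + 1) + (u + 1) * σ + D * (σ + 1 - t) - 2 * r * (t - 1) * t +
      t * η / u ^ 2 * (σ - 2 * u) := by
    rw [← hκt]
    have : η * Qbb = κ * Qbb - r * (t - 1) * m * Qbb := by rw [hη]; ring
    linarith
  -- The right side of `hsum`, affine in `σ` with positive slope, vanishes at `σ = u`.
  have hzero : A * (u + 1) + (u + 1) * u + D * (u + 1 - t) - 2 * r * (t - 1) * t -
      t * η / u = 0 := by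
    have hη' : t * η / u = (u + 1) / u - r * (t - 1) * t * (1 - r) := by
      rw [hη, hmdef, eq_sub_iff_add_eq, ← hκt]
      field_simp
      ring
    rw [hDu, hη']
    refine mul_left_cancel₀ hu0.ne' ?_
    field_simp
    linear_combination (u + 1) * hAu - 2 * h1
  have hη3 : t * η / u ^ 2 * (σ - 2 * u) = t * η / u ^ 2 * (σ - u) - t * η / u := by
    field_simp
    ring
  have hW : 0 < A + (u + 1) + D + t * η / u ^ 2 := by positivity
  have hfin : 0 ≤ (σ - u) * (A + (u + 1) + D + t * η / u ^ 2) := by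
    rw [hη3] at hsum
    linarith
  linarith [nonneg_of_mul_nonneg_left hfin hW]

theorem le_of_thetaFeasible_mycielskian [Nonempty V] {t u σ : ℝ} (ht : 1 ≤ t) (hu : t / 3 ≤ u)
    (hut : u ≤ t) (h : (u + t) ^ 2 * (t - u) = 4 * t * (t - 1))
    (hT : IsLeast {T | ThetaFeasible G T} (t - 1)) (hσ : ThetaFeasible (mycielskian G) σ) :
    u ≤ σ := by
  classical
  obtain ⟨Y, hY, hd, he⟩ := hσ
  -- For `t = 1` there is no edge to run duality on; one pair `b_v`, `z` suffices.
  rcases ht.eq_or_lt with rfl | ht'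
  · obtain ⟨v⟩ := ‹Nonempty V›
    have h1 : Y (Sum.inl (v, 1)) (Sum.inr ()) = -1 := he _ _ rfl
    have h2 := hY.two_mul_abs_le (Sum.inl (v, 1)) (Sum.inr ())
    rw [h1, abs_neg, abs_one] at h2
    linarith [hd (Sum.inl (v, 1)), hd (Sum.inr ())]
  obtain ⟨p, q, hpq⟩ : ∃ p q, G.Adj p q := by
    by_contra! hno
    have := hT.2 (show ThetaFeasible G 0 from
      ⟨_, IsPSDKernel.diagonal (d := fun _ => 0) fun _ => le_rfl, by simp,
        fun i j hij => (hno i j hij).elim⟩)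
    linarith
  obtain ⟨r, h1, h2, hr1, hr0, hr2⟩ := exists_cubic_param ht hu hut h
  have hu1 := one_le_of_cubic ht hu hut h
  obtain ⟨B, hB, hs, hB1, hF, hrow⟩ := exists_dual_optimal hT hpq
  simp only [add_sub_cancel] at hF hrow
  have htot : ∑ i, ∑ j, B i j = t := by
    rw [Finset.sum_comm]
    simp only [hrow, ← Finset.mul_sum, hB1, mul_one]
  obtain ⟨m, x, hx⟩ := hY.exists_inner
  let a : V → EuclideanSpace ℝ (Fin m) := fun v => x (Sum.inl (v, 0))
  let b : V → EuclideanSpace ℝ (Fin m) := fun v => x (Sum.inl (v, 1))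
  let z : EuclideanSpace ℝ (Fin m) := x (Sum.inr ())
  have haa : ∀ v w, G.Adj v w → inner ℝ (a v) (a w) = -1 := fun v w hvw => by
    rw [← hx]; exact he _ _ ⟨hvw, Or.inl rfl⟩
  have hab : ∀ v w, G.Adj v w → inner ℝ (a v) (b w) = -1 := fun v w hvw => by
    rw [← hx]; exact he _ _ ⟨hvw, Or.inl rfl⟩
  have hbz : ∀ v, inner ℝ (b v) z = -1 := fun v => by
    rw [← hx]; exact he _ _ rfl
  have hzz : inner ℝ z z ≤ σ := by rw [← hx]; exact hd _
  have hdiag : ∀ c : V → EuclideanSpace ℝ (Fin m), (∀ v, inner ℝ (c v) (c v) ≤ σ) →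
      ∑ v, B v v * inner ℝ (c v) (c v) ≤ σ := by
    intro c hc
    calc ∑ v, B v v * inner ℝ (c v) (c v) ≤ ∑ v, B v v * σ :=
          Finset.sum_le_sum fun v _ => mul_le_mul_of_nonneg_left (hc v) (hB.diag_nonneg v)
      _ = σ := by rw [← Finset.sum_mul, hB1, one_mul]
  have hQF : ∀ c e : V → EuclideanSpace ℝ (Fin m),
      ∑ i, ∑ j, ((if i = j then t * B i i else 0) - B i j) * inner ℝ (c i) (e j) =
        t * ∑ i, B i i * inner ℝ (c i) (e i) - ∑ i, ∑ j, B i j * inner ℝ (c i) (e j) := by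
    intro c e
    simp only [sub_mul, ite_mul, zero_mul, Finset.sum_sub_distrib, Finset.sum_ite_eq,
      Finset.mem_univ, if_true, Finset.mul_sum, mul_assoc]
  have hQaa := sum_mul_inner_of_adj hs haa
  have hQab := sum_mul_inner_of_adj hs hab
  rw [hB1, htot] at hQaa hQab
  -- At the construction for the upper bound the `y`-parts of this combination cancel, leaving a
  -- constant vector, which `t D - B` annihilates.
  have i1 := hF.combination_nonneg b a ((u + 1) / t) (-r)
  -- Here the extra coordinates cancel instead, leaving multiples of `y_v`, whose pairing with `B`
  -- is zero by complementary slackness.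
  have i2 := hB.combination_nonneg a b 1 (u * (1 - r))
  let β : EuclideanSpace ℝ (Fin m) := ∑ v, B v v • b v
  have hββ : ∑ i, B i i * inner ℝ (b i) β = inner ℝ β β := by
    conv_rhs => rw [show β = ∑ v, B v v • b v from rfl, sum_inner]
    simp only [real_inner_smul_left]
    rfl
  have hβz : inner ℝ β z = -1 := by
    rw [show β = ∑ v, B v v • b v from rfl, sum_inner]
    simp only [real_inner_smul_left, hbz, ← Finset.sum_mul, hB1]
    ring
  have hrow' : ∀ i, ∑ j, B i j = t * B i i := fun i => by
    rw [← hrow]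
    exact Finset.sum_congr rfl fun j _ => hB.symm i j
  -- A variance inequality: centring `b` at its weighted mean `β` bounds `t ‖β‖²` by the `B`-sum of
  -- `b`.
  have i4 := hB.combination_nonneg b (fun _ => β) 1 (-1)
  have e1 : ∑ i, ∑ j, B i j * inner ℝ (b i) β = t * inner ℝ β β := by
    simp only [← Finset.sum_mul, hrow', mul_assoc, ← Finset.mul_sum, hββ]
  have e2 : ∑ i, ∑ j, B i j * inner ℝ β β = t * inner ℝ β β := by
    simp only [← Finset.sum_mul, htot]
  rw [e1, e2] at i4
  have hcomm : ∑ i, B i i * inner ℝ (b i) (a i) = ∑ i, B i i * inner ℝ (a i) (b i) :=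
    Finset.sum_congr rfl fun i _ => by rw [real_inner_comm]
  have hcomm' : ∑ i, ∑ j, B i j * inner ℝ (b i) (a j) = ∑ i, ∑ j, B i j * inner ℝ (a i) (b j) := by
    rw [Finset.sum_comm]
    refine Finset.sum_congr rfl fun i _ => Finset.sum_congr rfl fun j _ => ?_
    rw [hB.symm, real_inner_comm]
  simp only [hQF] at i1
  rw [hcomm, hcomm', hQaa, hQab] at i1
  rw [hQaa, hQab] at i2
  -- The vector `u β + z` is zero at the construction.
  have i5 := real_inner_self_nonneg (x := u • β + z)
  rw [real_inner_add_add_self, real_inner_smul_left, real_inner_smul_left, real_inner_smul_right,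
    hβz] at i5
  refine le_of_dual_inequalities ht' hu1 h1 h2 hr1 (hr0 ht') hr2
    (hdiag a fun v => by rw [← hx]; exact hd _) (hdiag b fun v => by rw [← hx]; exact hd _) i1 i2 ?_
  have i6 : inner ℝ β β ≤ (∑ i, ∑ j, B i j * inner ℝ (b i) (b j)) / t := by
    rw [le_div_iff₀ (by linarith)]
    linarith
  have := mul_le_mul_of_nonneg_left i6 (sq_nonneg u)
  linarith

end Mycielskian

theorem theorem2 {V : Type*} [Finite V] [Nonempty V] (G : SimpleGraph V) :
    -- the minima that define both theta numbers are attained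
    IsLeast (thetaBarValues G) (thetaBar G) ∧
    IsLeast (thetaBarValues (mycielskian G)) (thetaBar (mycielskian G)) ∧
    -- the formula
    thetaBar (mycielskian G) =
      4 / 3 * thetaBar G *
          Real.cos (1 / 3 *
            Real.arccos (1 - 27 / (4 * thetaBar G) + 27 / (4 * thetaBar G ^ 2))) -
        1 / 3 * thetaBar G + 1 ∧
    -- the value is the largest real root of the cubic
    IsGreatest
      {x : ℝ | x ^ 3 + (thetaBar G - 3) * x ^ 2 + (3 - 2 * thetaBar G - thetaBar G ^ 2) * x +
        (-thetaBar G ^ 3 + 5 * thetaBar G ^ 2 - 3 * thetaBar G - 1) = 0}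
      (thetaBar (mycielskian G)) := by
  have := Fintype.ofFinite V
  obtain ⟨T, hT⟩ := exists_isLeast_thetaFeasible G
  have hG := isLeast_thetaBarValues_of_isLeast hT
  have htG : thetaBar G = 1 + T := hG.csInf_eq
  have ht1 : 1 ≤ thetaBar G := by
    have := ThetaFeasible.nonneg hT.1
    linarith
  have hT' : IsLeast {T | ThetaFeasible G T} (thetaBar G - 1) := by rwa [htG, add_sub_cancel_left]
  obtain ⟨h, hu, hut⟩ := cubic_trigonometric_root ht1 rfl
  set u := 4 / 3 * thetaBar G * Real.cos (1 / 3 *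
    Real.arccos (1 - 27 / (4 * thetaBar G) + 27 / (4 * thetaBar G ^ 2))) - 1 / 3 * thetaBar G
  have hM := isLeast_thetaBarValues_of_isLeast
    (⟨thetaFeasible_mycielskian ht1 hu hut h hT'.1,
      fun σ hσ => le_of_thetaFeasible_mycielskian ht1 hu hut h hT' hσ⟩ :
        IsLeast {T | ThetaFeasible (mycielskian G) T} u)
  have htM : thetaBar (mycielskian G) = 1 + u := hM.csInf_eq
  refine ⟨by rwa [htG], by rwa [htM], by rw [htM, add_comm], ?_, fun x hx => ?_⟩
  · rw [Set.mem_ofPred_eq, mycielskian_cubic_iff, htM, add_sub_cancel_left]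
    exact h
  · rw [Set.mem_ofPred_eq, mycielskian_cubic_iff] at hx
    have := cubic_root_le ht1 hu h hx
    linarith
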